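/- Let $\Gamma$ be a weighted graph on a finite nonempty vertex set $V$: a symmetric family of real weights $\gamma_{ij}=\gamma_{ji}$, whose edges are the pairs $\{i,j\}$ with $i\ne j$ and $\gamma_{ij}\neq 0$. An edge is black if its weight is positive and red if its weight is negative; let $e_1,\dots,e_R$ be the red edges. The Laplacian of $\Gamma$ is the matrix $L$ with $L_{ij}=\gamma_{ij}$ for $i\ne j$ and $L_{ii}=-\sum_{k\ne i}\gamma_{ik}$. With $N=|V|$ and $\lambda_1=0,\lambda_2,\dots,\lambda_N$ the eigenvalues of $L$ (with multiplicity), put $$\mathcal M(\Gamma)=\frac{(-1)^{N-1}}{N}\prod_{i=2}^N\lambda_i .$$ For $I\subseteq[R]$ let $\mathcal S_I(\Gamma)=\sum_T\tilde\pi(T)$, where $T$ runs over the spanning trees of $\Gamma$ that contain $e_i$ for every $i\in I$ and do not contain $e_j$ for any $j\in[R]\setminus I$, and $\tilde\pi(T)$ is the product of the weights of the black edges of $T$. (a) If the edges $e_i$, $i\in I$, form a forest, let $\Gamma_I$ be the weighted graph obtained from $\Gamma$ by deleting the red edges $e_j$, $j\notin I$, and contracting the red edges $e_i$, $i\in I$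 (end points are identified, weights of edges that become parallel are added, loops are discarded). Then $$\mathcal S_I(\Gamma)=\mathcal M(\Gamma_I).$$ (b) If the edges $e_i$, $i\in I$, contain a cycle, then $\mathcal S_I(\Gamma)=0$. (c) Keep the black weights fixed and give each red edge $e_i$ the weight $-t_i$. Then $\mathcal M$ is a polynomial in $t_1,\dots,t_R$ (the crossing polynomial), and for every $I\subseteq[R]$ its coefficient at the monomial $t^I=\prod_{i\in I}t_i$ is $(-1)^{|I|}\,\mathcal S_I(\Gamma)$. -/

import Mathlib

/-- A weighted graph on the vertex set `V`: a symmetric family of real weights `γ i j`.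
The diagonal values `γ i i` play no role anywhere below. -/
structure WeightedGraph (V : Type*) where
  /-- the weights `γ i j` -/
  weight : V → V → ℝ
  symm : ∀ i j, weight i j = weight j i

noncomputable section

namespace WeightedGraph

/-- The underlying simple graph: `i` and `j` are adjacent iff `i ≠ j` and `γ i j ≠ 0`. -/
def graph {V : Type*} (Γ : WeightedGraph V) : SimpleGraph V where
  Adj i j := i ≠ j ∧ Γ.weight i j ≠ 0
  symm := ⟨fun i j h => ⟨h.1.symm, by rw [Γ.symm j i]; exact h.2⟩⟩
  loopless := ⟨fun _ h => h.1 rfl⟩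

/-- The weight of the unordered pair `{i, j}`. -/
def edgeWeight {V : Type*} (Γ : WeightedGraph V) : Sym2 V → ℝ :=
  Sym2.lift ⟨Γ.weight, Γ.symm⟩

/-- The Laplacian: `L i j = γ i j` off the diagonal, and `L i i = - ∑_{k ≠ i} γ i k`. -/
def laplacian {V : Type*} [Fintype V] [DecidableEq V] (Γ : WeightedGraph V) : Matrix V V ℝ :=
  Matrix.of fun i j => if i = j then -∑ k with k ≠ i, Γ.weight i k else Γ.weight i j

/-- `M(Γ) = ((-1)^(N-1) / N) * ∏_{i=2}^N λ_i`, where `λ_1 = 0, λ_2, …, λ_N` are the eigenvalues of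
the Laplacian with multiplicity: one eigenvalue zero is left out of the product. -/
def crossing {V : Type*} [Fintype V] [DecidableEq V] (Γ : WeightedGraph V) : ℝ :=
  (-1) ^ (Fintype.card V - 1) / (Fintype.card V : ℝ) * (Γ.laplacian.charpoly.roots.erase 0).prod

open Classical in
/-- The set of edges. -/
def edges {V : Type*} [Fintype V] (Γ : WeightedGraph V) : Finset (Sym2 V) :=
  {e | e ∈ Γ.graph.edgeSet}

open Classical in
/-- The red edges are the edges of negative weight. They serve as the index set `[R]`. -/
abbrev RedEdge {V : Type*} [Fintype V] (Γ : WeightedGraph V) : Type _ :=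
  {e : Sym2 V // e ∈ Γ.edges.filter fun e => Γ.edgeWeight e < 0}

/-- A set of red edges, as a set of unordered pairs of vertices. -/
def toEdges {V : Type*} [Fintype V] {Γ : WeightedGraph V} (I : Finset Γ.RedEdge) :
    Finset (Sym2 V) :=
  I.map (Function.Embedding.subtype _)

open Classical in
/-- The set of (edge sets of) spanning trees. -/
def spanningTrees {V : Type*} [Fintype V] (Γ : WeightedGraph V) : Finset (Finset (Sym2 V)) :=
  {T ∈ Γ.edges.powerset | (SimpleGraph.fromEdgeSet (T : Set (Sym2 V))).IsTree}

open Classical in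
/-- The product of the weights of the black (positive) edges of `T`. -/
def blackProd {V : Type*} (Γ : WeightedGraph V) (T : Finset (Sym2 V)) : ℝ :=
  ∏ e ∈ T with 0 < Γ.edgeWeight e, Γ.edgeWeight e

open Classical in
/-- The spanning trees that contain every red edge in `I` and no red edge in `J`. -/
def treesThrough {V : Type*} [Fintype V] (Γ : WeightedGraph V) (I J : Finset Γ.RedEdge) :
    Finset (Finset (Sym2 V)) :=
  {T ∈ Γ.spanningTrees | (∀ e ∈ toEdges I, e ∈ T) ∧ ∀ e ∈ toEdges J, e ∉ T}

/-- `S_I(Γ)`: the sum of the products of the black weights over all spanning trees that contain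
the red edges in `I` and no other red edge. -/
def treeSum {V : Type*} [Fintype V] [DecidableEq V] (Γ : WeightedGraph V)
    (I : Finset Γ.RedEdge) : ℝ :=
  ∑ T ∈ Γ.treesThrough I Iᶜ, Γ.blackProd T

open Classical in
/-- Deletion of the edges in `J`. -/
def delete {V : Type*} (Γ : WeightedGraph V) (J : Finset (Sym2 V)) : WeightedGraph V where
  weight i j := if s(i, j) ∈ J then 0 else Γ.weight i j
  symm i j := by rw [Sym2.eq_swap, Γ.symm]

/-- The vertices after contraction of the edges in `J`: the classes of the equivalence relation
generated by identifying the end points of each edge in `J`. -/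
abbrev ContractedVertex {V : Type*} (J : Finset (Sym2 V)) : Type _ :=
  (SimpleGraph.fromEdgeSet (J : Set (Sym2 V))).ConnectedComponent

open Classical in
instance {V : Type*} [Fintype V] (J : Finset (Sym2 V)) : Fintype (ContractedVertex J) :=
  Fintype.ofFinite _

open Classical in
instance {V : Type*} (J : Finset (Sym2 V)) : DecidableEq (ContractedVertex J) :=
  fun _ _ => inferInstance

open Classical in
/-- Contraction of the edges in `J`: the end points of each edge are identified, and the weights of
edges that become parallel are added up. For a single edge `{v₁, v₂}` merged into `v*`, this is the
rule `γ v* w = γ v₁ w + γ v₂ w`. -/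
def contract {V : Type*} [Fintype V] (Γ : WeightedGraph V) (J : Finset (Sym2 V)) :
    WeightedGraph (ContractedVertex J) where
  weight C D := if C = D then 0 else
    ∑ i with SimpleGraph.connectedComponentMk _ i = C,
      ∑ j with SimpleGraph.connectedComponentMk _ j = D, Γ.weight i j
  symm C D := by
    rw [Finset.sum_comm]
    simp only [Γ.symm, eq_comm]

/-- `Γ_I`: first delete the red edges outside `I`, then contract the red edges in `I`. -/
def minor {V : Type*} [Fintype V] [DecidableEq V] (Γ : WeightedGraph V) (I : Finset Γ.RedEdge) :
    WeightedGraph (ContractedVertex (toEdges I)) :=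
  (Γ.delete (toEdges Iᶜ)).contract (toEdges I)

open Classical in
/-- The graph with the same black edges and with weight `- t e` on each red edge `e`. -/
def withRedWeights {V : Type*} [Fintype V] (Γ : WeightedGraph V) (t : Γ.RedEdge → ℝ) :
    WeightedGraph V where
  weight i j := if h : s(i, j) ∈ Γ.edges.filter fun e => Γ.edgeWeight e < 0
    then -t ⟨s(i, j), h⟩ else Γ.weight i j
  symm i j := by
    have h : s(i, j) = s(j, i) := Sym2.eq_swap
    simp only [h, Γ.symm i j]

/-- `P` is the crossing polynomial of `Γ`: the quantity `M`, as a polynomial in the variables `t`,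
where the red edge `e` has weight `- t e` and the black weights are fixed. -/
def IsCrossingPolynomial {V : Type*} [Fintype V] [DecidableEq V] (Γ : WeightedGraph V)
    (P : MvPolynomial Γ.RedEdge ℝ) : Prop :=
  ∀ t : Γ.RedEdge → ℝ, MvPolynomial.eval t P = (Γ.withRedWeights t).crossing

end WeightedGraph

end

/-! Parts (a) and (c) both rest on a matrix-tree theorem for multigraphs, `crossing_eq_sum_arcs`.
With the arcs as columns, `-L = U W Uᵀ` for the incidence matrix `U` and the diagonal matrix `W` of
weights. The coefficient of `X` in the characteristic polynomial is, up to sign, both the product of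
the remaining eigenvalues and the sum of the `N` principal minors of size `N - 1`. By Cauchy–Binet
each minor is a weighted sum of squared minors of the reduced incidence matrix, which are 1 or 0
according to connectedness. So the minors all agree, and the factor `1/N` averages them.

For (c), take the edges of `Γ` as arcs: a tree contributes its black product times `∏ (-t r)` over
its red part, and distinct red parts give distinct monomials. For (a), take the black edges as arcs
between contracted vertices: `S ↦ S ∪ I` matches the terms with spanning trees of red part `I`.
Connectedness passes through contraction (`contractedArcGraph_connected_iff`), and the edge counts
agree because `I` is a forest (`card_contractedVertex_add_card`). Part (b) holds because a subgraph
of a tree is acyclic. -/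

namespace Matrix

/-! ### The Cauchy–Binet formula -/

open Finset

variable {n E R : Type*} [Fintype n] [DecidableEq n] [CommRing R]

/-- Each row of `A * B` is a combination of rows of `B`; expand by multilinearity. -/
theorem det_mul_eq_sum_prod_mul_det [Fintype E] (A : Matrix n E R) (B : Matrix E n R) :
    (A * B).det = ∑ f : n → E, (∏ i, A i (f i)) * (B.submatrix f id).det := by
  have h : (A * B : Matrix n n R) = fun i => ∑ e, A i e • B e := by
    ext i j
    simp [Matrix.mul_apply]
  change detRowAlternating (A * B) = _
  rw [h]
  change (detRowAlternating : (n → R) [⋀^n]→ₗ[R] R).toMultilinearMap _ = _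
  rw [MultilinearMap.map_sum]
  refine Finset.sum_congr rfl fun f _ => ?_
  rw [MultilinearMap.map_smul_univ]
  rfl

/-- Reordering the selected rows by `σ` costs `sign σ`, which turns the sum into the Leibniz
expansion of the minor of `A`. -/
theorem sum_perm_prod_mul_det_submatrix (A : Matrix n E R) (B : Matrix E n R) (f : n → E) :
    ∑ σ : Equiv.Perm n, (∏ i, A i (f (σ i))) * (B.submatrix (f ∘ σ) id).det =
      (A.submatrix id f).det * (B.submatrix f id).det := by
  have h (σ : Equiv.Perm n) : (B.submatrix (f ∘ σ) id).det =
      Equiv.Perm.sign σ * (B.submatrix f id).det := by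
    rw [← det_permute, submatrix_submatrix]
    rfl
  simp_rw [h]
  rw [← det_transpose (A.submatrix id f), det_apply' (A.submatrix id f)ᵀ, Finset.sum_mul]
  refine Finset.sum_congr rfl fun σ _ => ?_
  simp only [transpose_apply, submatrix_apply, id_eq]
  ring

/-- The Cauchy–Binet formula, for a product of minors that depends only on the set of columns. -/
theorem det_mul_eq_sum_powersetCard [Fintype E] [DecidableEq E] (A : Matrix n E R)
    (B : Matrix E n R) (c : Finset E → R)
    (hc : ∀ f : n → E, Function.Injective f →
      (A.submatrix id f).det * (B.submatrix f id).det = c (univ.image f)) :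
    (A * B).det = ∑ S ∈ powersetCard (Fintype.card n) univ, c S := by
  rw [det_mul_eq_sum_prod_mul_det]
  have h0 : ∑ f : n → E, (∏ i, A i (f i)) * (B.submatrix f id).det =
      ∑ f : n → E with Function.Injective f, (∏ i, A i (f i)) * (B.submatrix f id).det := by
    refine (Finset.sum_subset (Finset.filter_subset _ _) fun f _ hf => ?_).symm
    have hf : ¬ Function.Injective f := by simpa using hf
    simp only [Function.Injective, not_forall] at hf
    obtain ⟨i, j, hij, hne⟩ := hf
    rw [det_zero_of_row_eq hne (by ext k; simp [hij]), mul_zero]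
  rw [h0, ← Finset.sum_fiberwise_of_maps_to (t := powersetCard (Fintype.card n) univ)
    (g := fun f : n → E => univ.image f)]
  · refine Finset.sum_congr rfl fun S hS => ?_
    have hS : S.card = Fintype.card n := (Finset.mem_powersetCard.mp hS).2
    -- A reference enumeration of `S`: the injections with image `S` are exactly `f₀ ∘ σ`.
    let f₀ : n ≃ S := Fintype.equivOfCardEq (by simp [hS])
    have hinj : Function.Injective fun i => (f₀ i : E) :=
      Subtype.val_injective.comp f₀.injective
    have himg : univ.image (fun i => (f₀ i : E)) = S := by
      ext e
      simp only [Finset.mem_image, Finset.mem_univ, true_and]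
      exact ⟨fun ⟨i, hi⟩ => hi ▸ (f₀ i).2, fun he => ⟨f₀.symm ⟨e, he⟩, by simp⟩⟩
    have hcS := hc _ hinj
    rw [himg] at hcS
    rw [← hcS, ← sum_perm_prod_mul_det_submatrix]
    symm
    refine Finset.sum_bij (fun σ _ i => (f₀ (σ i) : E)) ?_ ?_ ?_ ?_
    · intro σ _
      simp only [Finset.mem_filter, Finset.mem_univ, true_and]
      refine ⟨hinj.comp σ.injective, ?_⟩
      conv_rhs => rw [← himg]
      ext e
      simp only [Finset.mem_image, Finset.mem_univ, true_and]
      exact ⟨fun ⟨i, hi⟩ => ⟨σ i, hi⟩, fun ⟨i, hi⟩ => ⟨σ.symm i, by simpa using hi⟩⟩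
    · intro σ _ τ _ h
      ext i
      exact hinj (congrFun h i)
    · intro f hf
      simp only [Finset.mem_filter, Finset.mem_univ, true_and] at hf
      obtain ⟨hf, hfS⟩ := hf
      have hmem (i : n) : f i ∈ S := hfS ▸ Finset.mem_image_of_mem f (Finset.mem_univ i)
      let g : n → n := fun i => f₀.symm ⟨f i, hmem i⟩
      have hg : Function.Injective g := fun i j hij => hf (by simpa [g] using hij)
      refine ⟨Equiv.ofBijective g (Finite.injective_iff_bijective.mp hg), Finset.mem_univ _, ?_⟩
      ext i
      simp [g]
    · intro σ _
      rfl
  · intro f hf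
    have hf : Function.Injective f := by simpa using hf
    simp [Finset.mem_powersetCard, Finset.card_image_of_injective _ hf]

end Matrix

/-! ### Connectedness and incidence minors -/

namespace SimpleGraph

theorem Reachable.rel_of_adj {V : Type*} {G : SimpleGraph V} {r : V → V → Prop}
    (hrefl : ∀ v, r v v) (htrans : ∀ u v w, r u v → r v w → r u w)
    (hadj : ∀ u v, G.Adj u v → r u v) {u v : V} (h : G.Reachable u v) : r u v := by
  rw [reachable_iff_reflTransGen] at h
  induction h with
  | refl => exact hrefl _
  | tail _ h ih => exact htrans _ _ _ ih (hadj _ _ h)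

end SimpleGraph

/-- The coordinate at `v` of the incidence vector of an arc from `x` to `y`. -/
def incidenceCoord {V : Type*} [DecidableEq V] (x y v : V) : ℤ :=
  (if v = x then 1 else 0) - (if v = y then 1 else 0)

theorem sum_incidenceCoord {V : Type*} [DecidableEq V] [Fintype V] (x y : V) :
    ∑ v, incidenceCoord x y v = 0 := by
  simp [incidenceCoord]

section

open SimpleGraph Finset

variable {V E : Type*} (a b : E → V)

/-- The graph on `V` with the edges `{a e, b e}`, `e ∈ S`. -/
def arcGraph (S : Finset E) : SimpleGraph V :=
  fromEdgeSet ((fun e => s(a e, b e)) '' (S : Set E))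

theorem arcGraph_adj {S : Finset E} {u v : V} :
    (arcGraph a b S).Adj u v ↔ (∃ e ∈ S, s(a e, b e) = s(u, v)) ∧ u ≠ v := by
  simp [arcGraph]

/-- Squares of the maximal minors of a reduced incidence matrix detect connectedness. -/
theorem det_incidence_sq [DecidableEq V] [Fintype V] [DecidableEq E] {s : Finset V}
    {r : V} (hs : ∀ v, v ∈ s ↔ v ≠ r) (f : s → E)
    [Decidable (arcGraph a b (univ.image f)).Connected] :
    (Matrix.of fun i j : s => incidenceCoord (a (f j)) (b (f j)) (i : V)).det ^ 2 =
      if (arcGraph a b (univ.image f)).Connected then 1 else 0 := by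
  set G := arcGraph a b (univ.image f) with hG
  set D : Matrix s s ℤ := Matrix.of fun i j : s => incidenceCoord (a (f j)) (b (f j)) (i : V) with hD
  split_ifs with h
  -- Incidence vectors telescope along walks, so those of all pairs `(v, r)` lie in the integral
  -- column span. Off `r` they are the unit vectors, so `D` has an integral right inverse and
  -- determinant `±1`.
  · have key (u v : V) (huv : G.Reachable u v) : ∃ c : s → ℤ, ∀ i : s,
        (D.mulVec c) i = incidenceCoord u v i := by
      refine Reachable.rel_of_adj (G := G) (r := fun u v : V => ∃ c : s → ℤ, ∀ i : s,
        (D.mulVec c) i = incidenceCoord u v i) ?_ ?_ ?_ huv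
      · intro v
        exact ⟨0, by simp [incidenceCoord]⟩
      · rintro u v w ⟨c, hc⟩ ⟨d, hd⟩
        refine ⟨c + d, fun i => ?_⟩
        rw [Matrix.mulVec_add, Pi.add_apply, hc, hd]
        simp [incidenceCoord]
      · intro u v huv
        rw [hG, arcGraph_adj] at huv
        obtain ⟨⟨e, he, hes⟩, -⟩ := huv
        obtain ⟨j, -, rfl⟩ := Finset.mem_image.mp he
        rcases Sym2.eq_iff.mp hes with ⟨h1, h2⟩ | ⟨h1, h2⟩
        · exact ⟨Pi.single j 1, fun i => by simp [hD, h1, h2]⟩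
        · exact ⟨-Pi.single j 1, fun i => by
            simp [hD, h1, h2, Matrix.mulVec_neg, incidenceCoord]⟩
    choose c hc using fun v : s => key v r (h.preconnected v r)
    have hmul : D * (Matrix.of fun i j => c j i) = 1 := by
      ext i j
      have h1 := hc j i
      have h2 : (i : V) ≠ r := (hs i).mp i.2
      simp only [incidenceCoord, h2, if_false, sub_zero] at h1
      rw [Matrix.one_apply, Matrix.mul_apply]
      simp only [Subtype.ext_iff]
      exact h1
    have hunit : IsUnit D.det := by
      refine IsUnit.of_mul_eq_one (Matrix.of fun i j => c j i).det ?_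
      rw [← Matrix.det_mul, hmul, Matrix.det_one]
    rcases Int.isUnit_iff.mp hunit with h | h <;> simp [h]
  · have hex : ∃ v, ¬ G.Reachable r v := by
      by_contra hall
      push Not at hall
      have : Nonempty V := ⟨r⟩
      exact h ⟨fun u v => (hall u).symm.trans (hall v)⟩
    obtain ⟨v, hv⟩ := hex
    have hvs : v ∈ s := (hs v).mpr fun h => hv (h ▸ Reachable.refl (G := G) v)
    classical
    -- The indicator of the vertices not reachable from `r` is a left null vector. It vanishes at
    -- `r`, so dropping that coordinate loses nothing.
    let x : V → ℤ := fun i => if G.Reachable r i then 0 else 1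
    have hdet : D.det = 0 := by
      rw [← Matrix.exists_vecMul_eq_zero_iff]
      refine ⟨fun i => x i, fun h0 => ?_, ?_⟩
      · have := congrFun h0 ⟨v, hvs⟩
        simp [x, hv] at this
      · ext j
        have hab : x (a (f j)) = x (b (f j)) := by
          by_cases hne : a (f j) = b (f j)
          · rw [hne]
          · have hadj : G.Adj (a (f j)) (b (f j)) := by
              rw [hG, arcGraph_adj]
              exact ⟨⟨f j, Finset.mem_image_of_mem f (Finset.mem_univ j), rfl⟩, hne⟩
            have : G.Reachable r (a (f j)) ↔ G.Reachable r (b (f j)) :=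
              ⟨fun h => h.trans hadj.reachable, fun h => h.trans hadj.symm.reachable⟩
            simp only [x, this]
        have hsum : ∑ i : s, x i * incidenceCoord (a (f j)) (b (f j)) i =
            ∑ i : V, x i * incidenceCoord (a (f j)) (b (f j)) i := by
          rw [Finset.sum_coe_sort s fun i => x i * incidenceCoord (a (f j)) (b (f j)) i]
          refine Finset.sum_subset (Finset.subset_univ s) fun i _ hi => ?_
          have : i = r := by
            by_contra hne
            exact hi ((hs i).mpr hne)
          simp [x, this]
        simp only [Matrix.vecMul, dotProduct, hD, Matrix.of_apply, Pi.zero_apply]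
        rw [hsum]
        simp [incidenceCoord, mul_sub, hab]
    simp [hdet]

end

/-! ### The Laplacian and the matrix-tree theorem -/

/-- The characteristic polynomial splits over `ℝ`. Cancelling the factor `X` of one zero root leaves
the constant term of the product over the others. -/
theorem Matrix.IsHermitian.charpoly_coeff_one_of_det_eq_zero {V : Type*} [Fintype V]
    [DecidableEq V] {L : Matrix V V ℝ} (hL : L.IsHermitian) (h0 : L.det = 0) :
    L.charpoly.coeff 1 = (-1) ^ (Fintype.card V - 1) * (L.charpoly.roots.erase 0).prod := by
  have hroot : (0 : ℝ) ∈ L.charpoly.roots := by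
    rw [Polynomial.mem_roots L.charpoly_monic.ne_zero, Polynomial.IsRoot, Matrix.eval_charpoly]
    simp [Matrix.det_neg, h0]
  have hcard : L.charpoly.roots.card = Fintype.card V := by
    rw [← hL.splits_charpoly.natDegree_eq_card_roots, L.charpoly_natDegree_eq_dim]
  have hprod := hL.splits_charpoly.eq_prod_roots_of_monic L.charpoly_monic
  obtain ⟨m, hm⟩ := Multiset.exists_cons_of_mem hroot
  rw [hm, Multiset.map_cons, Multiset.prod_cons, Polynomial.C_0, sub_zero] at hprod
  rw [hm, Multiset.card_cons] at hcard
  rw [hm, Multiset.erase_cons_head, hprod, Polynomial.coeff_X_mul, Polynomial.coeff_zero_eq_eval_zero,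
    Polynomial.eval_multiset_prod, Multiset.map_map, ← hcard]
  simp

namespace WeightedGraph

open Finset

theorem laplacian_isHermitian {V : Type*} [Fintype V] [DecidableEq V] (Γ : WeightedGraph V) :
    Γ.laplacian.IsHermitian := by
  ext i j
  by_cases h : i = j
  · subst h
    simp
  · simp [laplacian, h, Ne.symm h, Γ.symm i j]

theorem sum_laplacian_apply {V : Type*} [Fintype V] [DecidableEq V] (Γ : WeightedGraph V) (i : V) :
    ∑ j, Γ.laplacian i j = 0 := by
  rw [← Finset.add_sum_erase _ _ (Finset.mem_univ i)]
  have h : ∑ j ∈ univ.erase i, Γ.laplacian i j = ∑ j with j ≠ i, Γ.weight i j := by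
    rw [show univ.filter (fun j => j ≠ i) = univ.erase i by ext; simp]
    refine Finset.sum_congr rfl fun j hj => ?_
    simp [laplacian, (Finset.ne_of_mem_erase hj).symm]
  rw [h]
  simp [laplacian]

theorem laplacian_det {V : Type*} [Fintype V] [DecidableEq V] [Nonempty V] (Γ : WeightedGraph V) :
    Γ.laplacian.det = 0 := by
  rw [← Matrix.exists_mulVec_eq_zero_iff]
  refine ⟨1, one_ne_zero, ?_⟩
  ext i
  simpa [Matrix.mulVec, dotProduct] using Γ.sum_laplacian_apply i

/-- Compares two expressions for the coefficient of `X`; passing to `-L` absorbs the sign. -/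
theorem crossing_eq_sum_det {V : Type*} [Fintype V] [DecidableEq V] [Nonempty V]
    (Γ : WeightedGraph V) :
    Γ.crossing = (Fintype.card V : ℝ)⁻¹ * ∑ s ∈ univ.powersetCard (Fintype.card V - 1),
      ((-Γ.laplacian).submatrix (Subtype.val : s → V) (Subtype.val : s → V)).det := by
  have hpos : 0 < Fintype.card V := Fintype.card_pos
  have h1 := Γ.laplacian_isHermitian.charpoly_coeff_one_of_det_eq_zero Γ.laplacian_det
  have h2 := Γ.laplacian.charpoly_coeff_eq_sum_minors (Fintype.card V - 1) (Nat.sub_le _ _)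
  rw [Nat.sub_sub_self hpos, h1] at h2
  rw [crossing, div_mul_eq_mul_div, h2, div_eq_inv_mul, Finset.mul_sum]
  congr 1
  refine Finset.sum_congr rfl fun s hs => ?_
  rw [Matrix.submatrix_neg, Pi.neg_apply, Pi.neg_apply, Matrix.det_neg, Fintype.card_coe,
    (Finset.mem_powersetCard.mp hs).2]

theorem incidenceCoord_mul_of_ne {V : Type*} [DecidableEq V] (x y : V) {i j : V} (hij : i ≠ j) :
    (incidenceCoord x y i * incidenceCoord x y j : ℤ) = if s(x, y) = s(i, j) then -1 else 0 := by
  unfold incidenceCoord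
  grind

variable {V E : Type*} [Fintype V] [DecidableEq V] [Fintype E]

/-- Off the diagonal only arcs joining `i` and `j` contribute. The diagonal follows because rows sum
to zero on both sides; loops have zero incidence vector, so they are harmless. -/
theorem neg_laplacian_apply (Γ : WeightedGraph V) (a b : E → V) (w : E → ℝ)
    (hw : ∀ i j, i ≠ j → Γ.weight i j = ∑ e with s(a e, b e) = s(i, j), w e) (i j : V) :
    -Γ.laplacian i j =
      ∑ e, w e * incidenceCoord (a e) (b e) i * (incidenceCoord (a e) (b e) j : ℤ) := by
  have hne (j : V) (hij : i ≠ j) : -Γ.laplacian i j =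
      ∑ e, w e * incidenceCoord (a e) (b e) i * (incidenceCoord (a e) (b e) j : ℤ) := by
    simp_rw [mul_assoc, ← Int.cast_mul, incidenceCoord_mul_of_ne _ _ hij]
    rw [show Γ.laplacian i j = Γ.weight i j by simp [laplacian, hij], hw i j hij,
      Finset.sum_filter, ← Finset.sum_neg_distrib]
    refine Finset.sum_congr rfl fun e _ => ?_
    split_ifs <;> simp
  by_cases hij : i = j
  · subst hij
    have h1 : ∑ j, -Γ.laplacian i j = 0 := by
      rw [Finset.sum_neg_distrib, Γ.sum_laplacian_apply, neg_zero]
    have h2 : ∑ j, ∑ e, w e * incidenceCoord (a e) (b e) i *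
        (incidenceCoord (a e) (b e) j : ℤ) = 0 := by
      rw [Finset.sum_comm]
      simp_rw [← Finset.mul_sum, ← Int.cast_sum, sum_incidenceCoord]
      simp
    rw [← Finset.add_sum_erase _ _ (Finset.mem_univ i)] at h1 h2
    rw [Finset.sum_congr rfl fun j hj => hne j (Finset.ne_of_mem_erase hj).symm] at h1
    linarith
  · exact hne j hij

open Classical in
/-- The weighted matrix-tree theorem for multigraphs: the quantity `M` of a weighted graph whose
weights are sums over parallel arcs. -/
theorem crossing_eq_sum_arcs [DecidableEq E] [Nonempty V] (Γ : WeightedGraph V)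
    (a b : E → V) (w : E → ℝ)
    (hw : ∀ i j, i ≠ j → Γ.weight i j = ∑ e with s(a e, b e) = s(i, j), w e) :
    Γ.crossing = ∑ S ∈ powersetCard (Fintype.card V - 1) univ with (arcGraph a b S).Connected,
      ∏ e ∈ S, w e := by
  have hpos : 0 < Fintype.card V := Fintype.card_pos
  have hminor (s : Finset V) (hs : s ∈ univ.powersetCard (Fintype.card V - 1)) :
      ((-Γ.laplacian).submatrix (Subtype.val : s → V) (Subtype.val : s → V)).det =
        ∑ S ∈ powersetCard (Fintype.card V - 1) univ with (arcGraph a b S).Connected,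
          ∏ e ∈ S, w e := by
    have hcard := (Finset.mem_powersetCard.mp hs).2
    obtain ⟨r, hr⟩ : ∃ r, sᶜ = {r} := by
      rw [← Finset.card_eq_one, Finset.card_compl]
      omega
    have hsr (v : V) : v ∈ s ↔ v ≠ r := by
      rw [← not_iff_not, ← Finset.mem_compl, hr]
      simp
    let U : Matrix s E ℝ := Matrix.of fun i e => (incidenceCoord (a e) (b e) (i : V) : ℝ)
    have hmul : (-Γ.laplacian).submatrix (Subtype.val : s → V) (Subtype.val : s → V) =
        (Matrix.of fun i e => w e * U i e) * U.transpose := by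
      ext i j
      rw [Matrix.mul_apply, Matrix.submatrix_apply, Matrix.neg_apply,
        neg_laplacian_apply Γ a b w hw]
      rfl
    rw [hmul, Matrix.det_mul_eq_sum_powersetCard _ _
      (fun S => if (arcGraph a b S).Connected then ∏ e ∈ S, w e else 0), Fintype.card_coe, hcard,
      Finset.sum_filter]
    intro f hf
    have h1 : ((Matrix.of fun i e => w e * U i e).submatrix id f).det =
        (∏ j, w (f j)) * (U.submatrix id f).det := by
      rw [← Matrix.det_mul_row]
      rfl
    have h2 : (U.submatrix id f).det = (((Matrix.of fun i j : s =>
        incidenceCoord (a (f j)) (b (f j)) (i : V)).det : ℤ) : ℝ) := by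
      exact ((Int.castRingHom ℝ).map_det _).symm
    have h3 : (U.transpose.submatrix f id).det = (U.submatrix id f).det := by
      rw [← Matrix.det_transpose]
      rfl
    rw [h1, h3, mul_assoc, ← sq, h2, ← Int.cast_pow, det_incidence_sq a b hsr f,
      Finset.prod_image fun _ _ _ _ h => hf h]
    split_ifs <;> simp
  -- All `N` minors have the same value, so the average is that value.
  rw [crossing_eq_sum_det, Finset.sum_congr rfl hminor, Finset.sum_const, Finset.card_powersetCard,
    Finset.card_univ, nsmul_eq_mul, ← mul_assoc]
  have hchoose : (Fintype.card V).choose (Fintype.card V - 1) = Fintype.card V := by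
    rw [Nat.choose_symm_of_eq_add (b := 1) (by omega), Nat.choose_one_right]
  rw [hchoose, inv_mul_cancel₀ (by exact_mod_cast hpos.ne'), one_mul]

end WeightedGraph

open SimpleGraph Finset

/-! ### Edge counts of trees and connected graphs -/

section

theorem SimpleGraph.natCard_edgeSet_fromEdgeSet_of_not_isDiag {V : Type*} {T : Finset (Sym2 V)}
    (hT : ∀ e ∈ T, ¬ e.IsDiag) : Nat.card (fromEdgeSet (T : Set (Sym2 V))).edgeSet = T.card := by
  have h : (fromEdgeSet (T : Set (Sym2 V))).edgeSet = T := by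
    ext e
    simpa [edgeSet_fromEdgeSet] using hT e
  rw [h]
  simp

variable {V : Type*} [Fintype V]

theorem SimpleGraph.isTree_fromEdgeSet_iff {T : Finset (Sym2 V)} (hT : ∀ e ∈ T, ¬ e.IsDiag) :
    (fromEdgeSet (T : Set (Sym2 V))).IsTree ↔
      (fromEdgeSet (T : Set (Sym2 V))).Connected ∧ T.card + 1 = Fintype.card V := by
  rw [isTree_iff_connected_and_card, natCard_edgeSet_fromEdgeSet_of_not_isDiag hT,
    Nat.card_eq_fintype_card]

theorem SimpleGraph.Connected.card_le_card_add_one_of_fromEdgeSet {T : Finset (Sym2 V)}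
    (h : (fromEdgeSet (T : Set (Sym2 V))).Connected) : Fintype.card V ≤ T.card + 1 := by
  have h1 := h.card_vert_le_card_edgeSet_add_one
  have h2 : Nat.card (fromEdgeSet (T : Set (Sym2 V))).edgeSet ≤ Nat.card (T : Set (Sym2 V)) :=
    Nat.card_mono T.finite_toSet (by simp [edgeSet_fromEdgeSet])
  simp only [Nat.card_eq_fintype_card, Fintype.card_coe, Finset.coe_sort_coe] at h1 h2
  omega

theorem arcGraph_connected_card_le {E : Type*} {a b : E → V} {S : Finset E}
    (h : (arcGraph a b S).Connected) : Fintype.card V ≤ S.card + 1 := by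
  classical
  have h1 : arcGraph a b S = fromEdgeSet (S.image (fun e => s(a e, b e)) : Set (Sym2 V)) := by
    simp [arcGraph]
  rw [h1] at h
  exact h.card_le_card_add_one_of_fromEdgeSet.trans (by gcongr; exact Finset.card_image_le)

end

namespace WeightedGraph

/-! ### Contraction -/

section

variable {V : Type*}

/-- The graph obtained by contracting the edges in `J`, with the edges in `S`. -/
noncomputable def contractedArcGraph (J S : Finset (Sym2 V)) : SimpleGraph (ContractedVertex J) :=
  arcGraph (fun e => connectedComponentMk (fromEdgeSet (J : Set (Sym2 V))) (Quot.out e).1)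
    (fun e => connectedComponentMk (fromEdgeSet (J : Set (Sym2 V))) (Quot.out e).2) S

theorem mk_out (e : Sym2 V) : s((Quot.out e).1, (Quot.out e).2) = e := Quot.out_eq e

/-- The orientation chosen by `Quot.out` is immaterial for unordered pairs of classes. -/
theorem mk_component_out (J : Finset (Sym2 V)) (i j : V) :
    s(connectedComponentMk (fromEdgeSet (J : Set (Sym2 V))) (Quot.out s(i, j)).1,
      connectedComponentMk (fromEdgeSet (J : Set (Sym2 V))) (Quot.out s(i, j)).2) =
    s(connectedComponentMk (fromEdgeSet (J : Set (Sym2 V))) i,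
      connectedComponentMk (fromEdgeSet (J : Set (Sym2 V))) j) := by
  exact congrArg (Sym2.map (connectedComponentMk (fromEdgeSet (J : Set (Sym2 V)))))
    (mk_out s(i, j))

theorem contractedArcGraph_adj {J S : Finset (Sym2 V)} {C D : ContractedVertex J} :
    (contractedArcGraph J S).Adj C D ↔ (∃ i j, s(i, j) ∈ S ∧
      connectedComponentMk _ i = C ∧ connectedComponentMk _ j = D) ∧ C ≠ D := by
  rw [contractedArcGraph, arcGraph_adj]
  refine and_congr_left fun _ => ⟨?_, ?_⟩
  · rintro ⟨e, he, h⟩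
    rw [← mk_out e] at he
    rcases Sym2.eq_iff.mp h with ⟨h1, h2⟩ | ⟨h1, h2⟩
    · exact ⟨_, _, he, h1, h2⟩
    · rw [Sym2.eq_swap] at he
      exact ⟨_, _, he, h2, h1⟩
  · rintro ⟨i, j, h, rfl, rfl⟩
    exact ⟨_, h, mk_component_out J i j⟩

/-- Contraction of edges preserves and reflects connectedness. -/
theorem contractedArcGraph_connected_iff [DecidableEq V] (J S : Finset (Sym2 V)) :
    (contractedArcGraph J S).Connected ↔
      (fromEdgeSet ((S ∪ J : Finset (Sym2 V)) : Set (Sym2 V))).Connected := by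
  set G := fromEdgeSet (J : Set (Sym2 V)) with hG
  set H := fromEdgeSet ((S ∪ J : Finset (Sym2 V)) : Set (Sym2 V)) with hH
  have hGH : G ≤ H := fromEdgeSet_mono (by simp)
  constructor
  · intro h
    have : Nonempty V := h.nonempty.map fun C => (Quot.exists_rep C).choose
    refine ⟨fun u v => ?_⟩
    -- Quantifying over all representatives makes the relation transitive and lets a path pass
    -- freely within a class.
    refine Reachable.rel_of_adj (G := contractedArcGraph J S) (r := fun C D : ContractedVertex J =>
      ∀ u v, connectedComponentMk _ u = C → connectedComponentMk _ v = D → H.Reachable u v)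
      ?_ ?_ ?_ (h.preconnected (connectedComponentMk _ u) (connectedComponentMk _ v)) u v rfl rfl
    · rintro C u v rfl h
      exact (ConnectedComponent.exact h.symm).mono hGH
    · rintro C D F h1 h2 u w hu hw
      obtain ⟨v, hv⟩ := Quot.exists_rep D
      exact (h1 u v hu hv).trans (h2 v w hv hw)
    · intro C D hCD u v hu hv
      obtain ⟨⟨i, j, hij, hi, hj⟩, hne⟩ := contractedArcGraph_adj.mp hCD
      have h1 : H.Reachable u i := (ConnectedComponent.exact (hu.trans hi.symm)).mono hGH
      have h2 : H.Reachable j v := (ConnectedComponent.exact (hj.trans hv.symm)).mono hGH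
      have h3 : H.Adj i j := by
        rw [hH, fromEdgeSet_adj]
        exact ⟨by simp [hij], fun h => hne (by rw [← hi, ← hj, h])⟩
      exact (h1.trans h3.reachable).trans h2
  · intro h
    have : Nonempty (ContractedVertex J) := h.nonempty.map (connectedComponentMk _)
    refine ⟨fun C D => ?_⟩
    obtain ⟨u, rfl⟩ := Quot.exists_rep C
    obtain ⟨v, rfl⟩ := Quot.exists_rep D
    refine Reachable.rel_of_adj (G := H) (r := fun u v : V => (contractedArcGraph J S).Reachable
      (connectedComponentMk _ u) (connectedComponentMk _ v)) (fun _ => Reachable.refl _)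
      (fun _ _ _ => Reachable.trans) ?_ (h.preconnected u v)
    intro u v huv
    by_cases hne : G.connectedComponentMk u = G.connectedComponentMk v
    · rw [hne]
    · rw [hH, fromEdgeSet_adj] at huv
      obtain ⟨hmem, huv⟩ := huv
      rcases Finset.mem_union.mp (Finset.mem_coe.mp hmem) with hS | hJ
      · exact (contractedArcGraph_adj.mpr ⟨⟨u, v, hS, rfl, rfl⟩, hne⟩).reachable
      · refine absurd (ConnectedComponent.sound (Adj.reachable ?_)) hne
        rw [hG, fromEdgeSet_adj]
        exact ⟨hJ, huv⟩

variable [Fintype V]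

/-- In a forest, the number of components plus the number of edges is the number of vertices. -/
theorem card_contractedVertex_add_card [DecidableEq V] [Nonempty V] {J : Finset (Sym2 V)}
    (hJ : ∀ e ∈ J, ¬ e.IsDiag) (hac : (fromEdgeSet (J : Set (Sym2 V))).IsAcyclic) :
    Fintype.card (ContractedVertex J) + J.card = Fintype.card V := by
  classical
  refine le_antisymm ?_ ?_
  -- Extend `J` to a spanning tree `T` of the complete graph; `T \ J` connects the contraction,
  -- which bounds the number of classes.
  · obtain ⟨T, hJT, -, hT⟩ := connected_top.exists_isTree_le_of_le_of_isAcyclic le_top hac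
    have hsub : J ⊆ T.edgeFinset := by
      intro e he
      have := edgeSet_mono hJT (show e ∈ _ by simpa [edgeSet_fromEdgeSet, he] using hJ e he)
      simpa using this
    have hunion : T.edgeFinset \ J ∪ J = T.edgeFinset := Finset.sdiff_union_of_subset hsub
    have hconn : (contractedArcGraph J (T.edgeFinset \ J)).Connected := by
      rw [contractedArcGraph_connected_iff, hunion]
      simpa using hT.connected
    have h1 := arcGraph_connected_card_le hconn
    have h2 := Finset.card_sdiff_add_card_eq_card hsub
    have h3 := hT.card_edgeFinset
    omega
  -- A star on class representatives, together with `J`, connects `V`; this bound needs no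
  -- acyclicity.
  · choose rep hrep using fun C : ContractedVertex J => Quot.exists_rep C
    let C₀ : ContractedVertex J := connectedComponentMk _ (Classical.arbitrary V)
    let S : Finset (Sym2 V) := (univ.erase C₀).image fun C => s(rep C₀, rep C)
    have hS : S.card ≤ Fintype.card (ContractedVertex J) - 1 := by
      refine Finset.card_image_le.trans ?_
      rw [Finset.card_erase_of_mem (Finset.mem_univ _), Finset.card_univ]
    have hpos : 0 < Fintype.card (ContractedVertex J) := Fintype.card_pos_iff.mpr ⟨C₀⟩
    have hreach (C : ContractedVertex J) : (contractedArcGraph J S).Reachable C₀ C := by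
      by_cases hC : C₀ = C
      · rw [hC]
      · refine (contractedArcGraph_adj.mpr ⟨⟨rep C₀, rep C, ?_, hrep _, hrep _⟩, hC⟩).reachable
        exact Finset.mem_image_of_mem _ (by simpa using Ne.symm hC)
    have hconn : (contractedArcGraph J S).Connected := by
      have : Nonempty (ContractedVertex J) := ⟨C₀⟩
      exact ⟨fun C D => (hreach C).symm.trans (hreach D)⟩
    rw [contractedArcGraph_connected_iff] at hconn
    have h1 := hconn.card_le_card_add_one_of_fromEdgeSet
    have h2 := Finset.card_union_le S J
    omega

open Classical in
/-- The weighted matrix-tree theorem for a weighted graph. -/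
theorem crossing_eq_sum_trees [DecidableEq V] [Nonempty V] (Γ : WeightedGraph V)
    (F : Finset (Sym2 V)) (hF : ∀ e ∈ F, ¬ e.IsDiag) (w : Sym2 V → ℝ)
    (hw : ∀ i j, i ≠ j → Γ.weight i j = if s(i, j) ∈ F then w s(i, j) else 0) :
    Γ.crossing = ∑ T ∈ F.powerset with (fromEdgeSet ((T : Finset (Sym2 V)) : Set (Sym2 V))).IsTree,
      ∏ e ∈ T, w e := by
  have hpos : 0 < Fintype.card V := Fintype.card_pos
  -- All unordered pairs serve as arcs, with weight 0 outside `F`, so sets not inside `F` drop out.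
  rw [crossing_eq_sum_arcs Γ (fun e : Sym2 V => (Quot.out e).1) (fun e => (Quot.out e).2)
    (fun e => if e ∈ F then w e else 0)]
  · have harc (S : Finset (Sym2 V)) : arcGraph (fun e : Sym2 V => (Quot.out e).1)
        (fun e => (Quot.out e).2) S = fromEdgeSet (S : Set (Sym2 V)) := by
      simp [arcGraph, mk_out]
    simp_rw [harc]
    symm
    refine Finset.sum_subset_zero_on_sdiff ?_ ?_ ?_
    · intro T hT
      rw [Finset.mem_filter, Finset.mem_powerset] at hT
      have := (isTree_fromEdgeSet_iff fun e he => hF e (hT.1 he)).mp hT.2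
      rw [Finset.mem_filter, Finset.mem_powersetCard]
      exact ⟨⟨Finset.subset_univ _, by omega⟩, this.1⟩
    · intro T hT
      rw [Finset.mem_sdiff, Finset.mem_filter, Finset.mem_filter, Finset.mem_powersetCard,
        Finset.mem_powerset] at hT
      obtain ⟨⟨⟨-, hcard⟩, hconn⟩, hT⟩ := hT
      have hsub : ¬ T ⊆ F := fun hsub => hT ⟨hsub,
        (isTree_fromEdgeSet_iff fun e he => hF e (hsub he)).mpr ⟨hconn, by omega⟩⟩
      obtain ⟨e, he, heF⟩ := Finset.not_subset.mp hsub
      exact Finset.prod_eq_zero he (by simp [heF])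
    · intro T hT
      rw [Finset.mem_filter, Finset.mem_powerset] at hT
      refine Finset.prod_congr rfl fun e he => ?_
      rw [if_pos (hT.1 he)]
  · intro i j hij
    simp only [mk_out]
    rw [hw i j hij, Finset.sum_filter]
    simp

end

/-! ### Spanning trees, red parts and the crossing polynomial -/

section

variable {V : Type*} [Fintype V] {Γ : WeightedGraph V}

theorem mk_mem_edges {i j : V} : s(i, j) ∈ Γ.edges ↔ i ≠ j ∧ Γ.weight i j ≠ 0 := by
  refine (@Finset.mem_filter _ _ (_) _ _).trans ?_
  rw [and_iff_right (Finset.mem_univ _), mem_edgeSet]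
  rfl

theorem not_isDiag_of_mem_edges {e : Sym2 V} (h : e ∈ Γ.edges) : ¬ e.IsDiag := by
  induction e with
  | _ i j => simpa using (mk_mem_edges.mp h).1

theorem edgeWeight_ne_zero {e : Sym2 V} (h : e ∈ Γ.edges) : Γ.edgeWeight e ≠ 0 := by
  induction e with
  | _ i j => exact (mk_mem_edges.mp h).2

theorem RedEdge.mem_edges (r : Γ.RedEdge) : (r : Sym2 V) ∈ Γ.edges :=
  (Finset.mem_filter.mp r.2).1

theorem RedEdge.edgeWeight_neg (r : Γ.RedEdge) : Γ.edgeWeight r < 0 :=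
  (Finset.mem_filter.mp r.2).2

theorem mem_toEdges {I : Finset Γ.RedEdge} {e : Sym2 V} :
    e ∈ toEdges I ↔ ∃ h, (⟨e, h⟩ : Γ.RedEdge) ∈ I := by
  simp [toEdges]

theorem mem_edges_of_mem_toEdges {I : Finset Γ.RedEdge} {e : Sym2 V} (he : e ∈ toEdges I) :
    e ∈ Γ.edges :=
  let ⟨h, _⟩ := mem_toEdges.mp he
  RedEdge.mem_edges ⟨e, h⟩

theorem edgeWeight_neg_of_mem_toEdges {I : Finset Γ.RedEdge} {e : Sym2 V} (he : e ∈ toEdges I) :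
    Γ.edgeWeight e < 0 :=
  let ⟨h, _⟩ := mem_toEdges.mp he
  RedEdge.edgeWeight_neg ⟨e, h⟩

open Classical in
/-- The red edges in a set of edges. -/
noncomputable def redPart (Γ : WeightedGraph V) (T : Finset (Sym2 V)) : Finset Γ.RedEdge :=
  univ.filter fun r => (r : Sym2 V) ∈ T

theorem mem_redPart {T : Finset (Sym2 V)} {r : Γ.RedEdge} : r ∈ Γ.redPart T ↔ (r : Sym2 V) ∈ T := by
  simp [redPart]

theorem toEdges_redPart [DecidablePred fun e => Γ.edgeWeight e < 0] {T : Finset (Sym2 V)}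
    (hT : T ⊆ Γ.edges) : toEdges (Γ.redPart T) = T.filter fun e => Γ.edgeWeight e < 0 := by
  ext e
  simp only [mem_toEdges, mem_redPart, Finset.mem_filter]
  exact ⟨fun ⟨h, he⟩ => ⟨he, h.2⟩, fun ⟨he, h⟩ => ⟨⟨hT he, h⟩, he⟩⟩

theorem mem_spanningTrees {T : Finset (Sym2 V)} :
    T ∈ Γ.spanningTrees ↔ T ⊆ Γ.edges ∧ (fromEdgeSet (T : Set (Sym2 V))).IsTree := by
  simp [spanningTrees]

theorem mem_treesThrough {I J : Finset Γ.RedEdge} {T : Finset (Sym2 V)} :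
    T ∈ Γ.treesThrough I J ↔ T ∈ Γ.spanningTrees ∧ toEdges I ⊆ T ∧ ∀ e ∈ toEdges J, e ∉ T :=
  @Finset.mem_filter _ _ (_) _ _

variable [DecidableEq V]

theorem mem_treesThrough_compl {I : Finset Γ.RedEdge} {T : Finset (Sym2 V)} :
    T ∈ Γ.treesThrough I Iᶜ ↔ T ∈ Γ.spanningTrees ∧ Γ.redPart T = I := by
  rw [mem_treesThrough]
  refine and_congr_right fun _ => ?_
  have hto (J : Finset Γ.RedEdge) (p : Sym2 V → Prop) :
      (∀ e ∈ toEdges J, p e) ↔ ∀ r ∈ J, p r := by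
    simp [toEdges]
  simp only [Finset.subset_iff, hto, Finset.ext_iff, mem_redPart, Finset.mem_compl]
  exact ⟨fun h r => ⟨fun hT => by_contra fun hI => h.2 r hI hT, fun hI => h.1 r hI⟩,
    fun h => ⟨fun r hr => (h r).mpr hr, fun r hr hT => hr ((h r).mp hT)⟩⟩

theorem treeSum_eq_zero {I : Finset Γ.RedEdge}
    (hI : ¬ (fromEdgeSet (toEdges I : Set (Sym2 V))).IsAcyclic) : Γ.treeSum I = 0 := by
  rw [treeSum]
  refine Finset.sum_eq_zero fun T hT => absurd ?_ hI
  rw [mem_treesThrough, mem_spanningTrees] at hT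
  exact hT.1.2.isAcyclic.anti (fromEdgeSet_mono (Finset.coe_subset.mpr hT.2.1))

open Classical in
/-- The crossing polynomial, as a sum over spanning trees. -/
noncomputable def crossingPolynomial (Γ : WeightedGraph V) : MvPolynomial Γ.RedEdge ℝ :=
  ∑ T ∈ Γ.spanningTrees, MvPolynomial.monomial (∑ e ∈ Γ.redPart T, Finsupp.single e 1)
    ((-1) ^ (Γ.redPart T).card * Γ.blackProd T)

theorem isCrossingPolynomial_crossingPolynomial [Nonempty V] :
    Γ.IsCrossingPolynomial Γ.crossingPolynomial := by
  classical
  intro t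
  -- The index set stays `Γ.edges` for every `t`, even where some `t r` is zero or negative.
  have hcross := crossing_eq_sum_trees (Γ.withRedWeights t) Γ.edges
    (fun e he => not_isDiag_of_mem_edges he)
    (fun e => if h : e ∈ Γ.edges.filter fun e => Γ.edgeWeight e < 0 then -t ⟨e, h⟩
      else Γ.edgeWeight e) (fun i j hij => by
        by_cases h : s(i, j) ∈ Γ.edges
        · rw [if_pos h]
          simp only [withRedWeights]
          congr!
        · have hred : s(i, j) ∉ Γ.edges.filter fun e => Γ.edgeWeight e < 0 :=
            fun hr => h (Finset.mem_filter.mp hr).1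
          have hz : Γ.weight i j = 0 := by
            by_contra hne
            exact h (mk_mem_edges.mpr ⟨hij, hne⟩)
          rw [if_neg h]
          simp only [withRedWeights]
          rw [dif_neg hred, hz])
  rw [hcross, crossingPolynomial, map_sum]
  have hset : Γ.spanningTrees = Γ.edges.powerset.filter
      fun T : Finset (Sym2 V) => (fromEdgeSet (T : Set (Sym2 V))).IsTree := by
    ext T
    simp [mem_spanningTrees]
  rw [hset]
  refine Finset.sum_congr rfl fun T hT => ?_
  have hT : T ⊆ Γ.edges := Finset.mem_powerset.mp (Finset.mem_filter.mp hT).1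
  rw [← Finset.prod_filter_mul_prod_filter_not T (fun e => Γ.edgeWeight e < 0),
    ← toEdges_redPart hT, toEdges, Finset.prod_map]
  have hred : ∏ r ∈ Γ.redPart T, (if h : (Function.Embedding.subtype _ r : Sym2 V) ∈
      Γ.edges.filter fun e => Γ.edgeWeight e < 0 then -t ⟨_, h⟩ else Γ.edgeWeight r) =
      (-1) ^ (Γ.redPart T).card * ∏ r ∈ Γ.redPart T, t r := by
    rw [← Finset.prod_const, ← Finset.prod_mul_distrib]
    refine Finset.prod_congr rfl fun r _ => ?_
    refine (dif_pos r.2).trans ?_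
    simp
  have hblack : ∏ e ∈ T with ¬ Γ.edgeWeight e < 0, (if h : e ∈
      Γ.edges.filter fun e => Γ.edgeWeight e < 0 then -t ⟨e, h⟩ else Γ.edgeWeight e) =
      Γ.blackProd T := by
    rw [blackProd]
    refine Finset.prod_congr (Finset.filter_congr fun e he => ?_) fun e he => ?_
    · exact ⟨fun h => lt_of_le_of_ne (not_lt.mp h) (edgeWeight_ne_zero (hT he)).symm,
        fun h => h.le.not_gt⟩
    · have h (h : e ∈ Γ.edges.filter fun e => Γ.edgeWeight e < 0) : False :=
        (Finset.mem_filter.mp he).2.not_gt (Finset.mem_filter.mp h).2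
      exact dif_neg h
  rw [hblack]
  refine Eq.trans ?_ (congrArg (· * Γ.blackProd T) hred.symm)
  rw [MvPolynomial.eval_monomial, Finsupp.prod_fintype _ _ fun _ => pow_zero _]
  have hexp (r : Γ.RedEdge) : (∑ e ∈ Γ.redPart T, Finsupp.single e 1 : Γ.RedEdge →₀ ℕ) r =
      if r ∈ Γ.redPart T then 1 else 0 := by
    simp [Finsupp.finsetSum_apply, Finsupp.single_apply]
  simp_rw [hexp, pow_ite, pow_one, pow_zero]
  rw [Finset.prod_ite_mem, Finset.univ_inter]
  ring

/-- The exponent vector is the indicator function of `I`, so a squarefree monomial determines the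
red part. -/
theorem sum_single_one_injective {σ : Type*} :
    Function.Injective fun I : Finset σ => (∑ e ∈ I, Finsupp.single e 1 : σ →₀ ℕ) := by
  classical
  intro I J h
  ext r
  have := DFunLike.congr_fun h r
  simp only [Finsupp.finsetSum_apply, Finsupp.single_apply, Finset.sum_ite_eq'] at this
  by_cases h1 : r ∈ I <;> by_cases h2 : r ∈ J <;> simp_all

theorem coeff_crossingPolynomial (I : Finset Γ.RedEdge) :
    Γ.crossingPolynomial.coeff (∑ e ∈ I, Finsupp.single e 1) = (-1) ^ I.card * Γ.treeSum I := by
  classical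
  rw [crossingPolynomial, MvPolynomial.coeff_sum, treeSum, Finset.mul_sum]
  have hset : Γ.treesThrough I Iᶜ = Γ.spanningTrees.filter fun T => Γ.redPart T = I := by
    ext T
    rw [mem_treesThrough_compl, Finset.mem_filter]
  rw [hset, Finset.sum_filter]
  refine Finset.sum_congr rfl fun T _ => ?_
  rw [MvPolynomial.coeff_monomial]
  simp only [sum_single_one_injective.eq_iff]
  split_ifs with h
  · rw [h]
  · rfl

/-! ### Spanning trees and the contracted graph -/

open Classical in
/-- Distinct contracted vertices are joined in `Γ_I` by the sum of the weights of the black edges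
between them. -/
theorem minor_weight_eq_sum (I : Finset Γ.RedEdge) {C D : ContractedVertex (toEdges I)}
    (hCD : C ≠ D) :
    (Γ.minor I).weight C D = ∑ e with s(connectedComponentMk _ (Quot.out e).1,
      connectedComponentMk _ (Quot.out e).2) = s(C, D),
        if e ∈ Γ.edges ∧ 0 < Γ.edgeWeight e then Γ.edgeWeight e else 0 := by
  have h1 : (Γ.minor I).weight C D =
      ∑ p : V × V with connectedComponentMk _ p.1 = C ∧ connectedComponentMk _ p.2 = D,
        (Γ.delete (toEdges Iᶜ)).weight p.1 p.2 := by
    rw [minor, contract]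
    simp only [if_neg hCD]
    rw [← Finset.univ_product_univ, Finset.filter_product (fun i => connectedComponentMk _ i = C)
      (fun j => connectedComponentMk _ j = D), Finset.sum_product]
  rw [h1]
  refine Finset.sum_bij (fun p _ => s(p.1, p.2)) ?_ ?_ ?_ ?_
  · rintro ⟨i, j⟩ h
    obtain ⟨hi, hj⟩ := (Finset.mem_filter.mp h).2
    refine Finset.mem_filter.mpr ⟨Finset.mem_univ _, ?_⟩
    rw [mk_component_out]
    simp only at hi hj
    rw [hi, hj]
  -- Since `C ≠ D`, an edge between them has only one orientation from `C` to `D`.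
  · rintro ⟨i, j⟩ h ⟨k, l⟩ h' heq
    obtain ⟨hi, hj⟩ := (Finset.mem_filter.mp h).2
    obtain ⟨hk, hl⟩ := (Finset.mem_filter.mp h').2
    rcases Sym2.eq_iff.mp heq with ⟨h1, h2⟩ | ⟨h1, h2⟩
    · exact Prod.ext h1 h2
    · simp only at h1 h2 hi hl
      exact absurd (by rw [← hi, h1, hl]) hCD
  · intro e he
    have he := (Finset.mem_filter.mp he).2
    rcases Sym2.eq_iff.mp he with ⟨h1, h2⟩ | ⟨h1, h2⟩
    · exact ⟨((Quot.out e).1, (Quot.out e).2), by simp [h1, h2], mk_out e⟩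
    · exact ⟨((Quot.out e).2, (Quot.out e).1), by simp [h1, h2], Sym2.eq_swap.trans (mk_out e)⟩
  · rintro ⟨i, j⟩ h
    obtain ⟨hi, hj⟩ := (Finset.mem_filter.mp h).2
    simp only at hi hj
    have hij : i ≠ j := fun hij => hCD (by rw [← hi, ← hj, hij])
    -- Edges of `I` lie inside a class and other red edges are deleted, so only black weights
    -- survive.
    have hI : s(i, j) ∉ toEdges I := by
      intro hmem
      refine hCD ?_
      rw [← hi, ← hj]
      refine ConnectedComponent.sound (Adj.reachable ?_)
      rw [fromEdgeSet_adj]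
      exact ⟨hmem, hij⟩
    simp only [delete]
    by_cases hblack : s(i, j) ∈ Γ.edges ∧ 0 < Γ.edgeWeight s(i, j)
    · rw [if_pos hblack, if_neg fun h => hblack.2.not_gt (edgeWeight_neg_of_mem_toEdges h)]
      rfl
    · rw [if_neg hblack]
      split_ifs with hc
      · rfl
      · by_contra hne
        have hmem : s(i, j) ∈ Γ.edges := mk_mem_edges.mpr ⟨hij, hne⟩
        have hneg : Γ.edgeWeight s(i, j) < 0 :=
          lt_of_le_of_ne (not_lt.mp fun h => hblack ⟨hmem, h⟩) hne
        have hr : s(i, j) ∈ Γ.edges.filter fun e => Γ.edgeWeight e < 0 :=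
          Finset.mem_filter.mpr ⟨hmem, hneg⟩
        by_cases hrI : (⟨s(i, j), hr⟩ : Γ.RedEdge) ∈ I
        · exact hI (mem_toEdges.mpr ⟨hr, hrI⟩)
        · exact hc (mem_toEdges.mpr ⟨hr, Finset.mem_compl.mpr hrI⟩)

theorem treeSum_eq_crossing_minor [Nonempty V] {I : Finset Γ.RedEdge}
    (hI : (fromEdgeSet (toEdges I : Set (Sym2 V))).IsAcyclic) :
    Γ.treeSum I = (Γ.minor I).crossing := by
  classical
  have hIdiag (e : Sym2 V) (he : e ∈ toEdges I) : ¬ e.IsDiag :=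
    not_isDiag_of_mem_edges (mem_edges_of_mem_toEdges he)
  have hcard := card_contractedVertex_add_card hIdiag hI
  have : Nonempty (ContractedVertex (toEdges I)) :=
    ⟨connectedComponentMk _ (Classical.arbitrary V)⟩
  have hpos : 0 < Fintype.card (ContractedVertex (toEdges I)) := Fintype.card_pos
  rw [crossing_eq_sum_arcs (Γ.minor I)
    (fun e : Sym2 V => connectedComponentMk (fromEdgeSet (toEdges I : Set (Sym2 V))) (Quot.out e).1)
    (fun e => connectedComponentMk (fromEdgeSet (toEdges I : Set (Sym2 V))) (Quot.out e).2)
    (fun e => if e ∈ Γ.edges ∧ 0 < Γ.edgeWeight e then Γ.edgeWeight e else 0)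
    (fun C D hCD => minor_weight_eq_sum I hCD)]
  have hdisj {S : Finset (Sym2 V)} (hS : ∀ e ∈ S, e ∈ Γ.edges ∧ 0 < Γ.edgeWeight e) :
      Disjoint S (toEdges I) :=
    Finset.disjoint_left.mpr fun e he h => (hS e he).2.not_gt (edgeWeight_neg_of_mem_toEdges h)
  symm
  -- A nonzero term forces `S` to consist of black edges, hence to be disjoint from `I` and
  -- recoverable from the union.
  refine Finset.sum_bij_ne_zero (fun S _ _ => S ∪ toEdges I) ?_ ?_ ?_ ?_
  all_goals
    have hblack {S : Finset (Sym2 V)}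
        (h : ∏ e ∈ S, (if e ∈ Γ.edges ∧ 0 < Γ.edgeWeight e then Γ.edgeWeight e else 0) ≠ 0) :
        ∀ e ∈ S, e ∈ Γ.edges ∧ 0 < Γ.edgeWeight e := fun e he => by
      by_contra hne
      exact h (Finset.prod_eq_zero he (if_neg hne))
  · intro S hS h0
    have hS := Finset.mem_filter.mp hS
    have hSc := (Finset.mem_powersetCard.mp hS.1).2
    have hb := hblack h0
    have hsub : S ∪ toEdges I ⊆ Γ.edges :=
      Finset.union_subset (fun e he => (hb e he).1) fun e he => mem_edges_of_mem_toEdges he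
    rw [mem_treesThrough_compl, mem_spanningTrees,
      isTree_fromEdgeSet_iff fun e he => not_isDiag_of_mem_edges (hsub he)]
    refine ⟨⟨hsub, (contractedArcGraph_connected_iff _ _).mp hS.2, ?_⟩, ?_⟩
    · rw [Finset.card_union_of_disjoint (hdisj hb)]
      omega
    · ext r
      rw [mem_redPart, Finset.mem_union, mem_toEdges]
      exact ⟨fun h => h.elim (fun h => absurd r.edgeWeight_neg (hb _ h).2.not_gt) fun h => h.2,
        fun h => Or.inr ⟨r.2, h⟩⟩
  · intro S hS h0 S' hS' h0' heq
    have hd := hdisj (hblack h0)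
    have hd' := hdisj (hblack h0')
    rw [← Finset.union_sdiff_cancel_right hd, heq, Finset.union_sdiff_cancel_right hd']
  · intro T hT _
    rw [mem_treesThrough_compl, mem_spanningTrees] at hT
    obtain ⟨⟨hTe, hT⟩, hred⟩ := hT
    have hIT := toEdges_redPart hTe
    rw [hred] at hIT
    have hsub : toEdges I ⊆ T := hIT ▸ Finset.filter_subset _ _
    have hun : T \ toEdges I ∪ toEdges I = T := Finset.sdiff_union_of_subset hsub
    have hb (e : Sym2 V) (he : e ∈ T \ toEdges I) : e ∈ Γ.edges ∧ 0 < Γ.edgeWeight e := by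
      rw [hIT, Finset.mem_sdiff, Finset.mem_filter] at he
      exact ⟨hTe he.1, lt_of_le_of_ne (not_lt.mp fun h => he.2 ⟨he.1, h⟩)
        (edgeWeight_ne_zero (hTe he.1)).symm⟩
    have htree := (isTree_fromEdgeSet_iff fun e he => not_isDiag_of_mem_edges (hTe he)).mp hT
    refine ⟨T \ toEdges I, ?_, ?_, hun⟩
    -- The tree has `N - 1` edges and contraction removes `|I|` vertices, leaving one edge fewer
    -- than the number of classes.
    · have h2 := Finset.card_sdiff_add_card_eq_card hsub
      refine Finset.mem_filter.mpr ⟨Finset.mem_powersetCard.mpr ⟨Finset.subset_univ _, ?_⟩, ?_⟩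
      · omega
      · refine (contractedArcGraph_connected_iff _ _).mpr ?_
        rw [hun]
        exact htree.1
    · refine Finset.prod_ne_zero_iff.mpr fun e he => ?_
      rw [if_pos (hb e he)]
      exact (hb e he).2.ne'
  · intro S hS h0
    have hb := hblack h0
    rw [blackProd]
    have hfilter : (S ∪ toEdges I).filter (fun e => 0 < Γ.edgeWeight e) = S := by
      ext e
      rw [Finset.mem_filter, Finset.mem_union]
      exact ⟨fun h => h.1.resolve_right fun he => h.2.not_gt (edgeWeight_neg_of_mem_toEdges he),
        fun h => ⟨Or.inl h, (hb e h).2⟩⟩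
    rw [hfilter]
    exact Finset.prod_congr rfl fun e he => if_pos (hb e he)

end

end WeightedGraph

theorem mainTheorem11 {V : Type*} [Fintype V] [DecidableEq V] [Nonempty V]
    (Γ : WeightedGraph V) :
    (∀ I : Finset Γ.RedEdge,
      (SimpleGraph.fromEdgeSet (WeightedGraph.toEdges I : Set (Sym2 V))).IsAcyclic →
        Γ.treeSum I = (Γ.minor I).crossing) ∧
    (∀ I : Finset Γ.RedEdge,
      ¬ (SimpleGraph.fromEdgeSet (WeightedGraph.toEdges I : Set (Sym2 V))).IsAcyclic →
        Γ.treeSum I = 0) ∧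
    ∃ P : MvPolynomial Γ.RedEdge ℝ, Γ.IsCrossingPolynomial P ∧
      ∀ I : Finset Γ.RedEdge,
        P.coeff (∑ e ∈ I, Finsupp.single e 1) = (-1) ^ I.card * Γ.treeSum I :=
  ⟨fun _ => WeightedGraph.treeSum_eq_crossing_minor, fun _ => WeightedGraph.treeSum_eq_zero,
    Γ.crossingPolynomial, WeightedGraph.isCrossingPolynomial_crossingPolynomial,
    WeightedGraph.coeff_crossingPolynomial⟩
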